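/- Let $N\ge 1$ and let $\mathcal A$ be a Markov generator on $L^1(\mathbb R^N)$, i.e. the infinitesimal generator of a strongly continuous semigroup of Markov operators on $L^1(\mathbb R^N)$, where an operator $T$ is called Markov if either $0\le f\le 1\Rightarrow 0\le Tf\le 1$, or $f\ge 0\Rightarrow Tf\ge 0$ and $\int Tf=\int f$. Let $0\le\varphi\in L^1(\mathbb R^N)$ and let $v$ be a (mild) solution of $$\partial_t v=\mathcal A v\ \text{ in }\mathbb R^N\times(0,\infty),\qquad v(\cdot,0)=\varphi ,$$ i.e. $t\mapsto v(\cdot,t)\in L^1(\mathbb R^N)$ is continuous on $[0,\infty)$, equals $\varphi$ at $t=0$, and $\int_0^t v(\cdot,s)\,ds\in D(\mathcal A)$ with $\mathcal A\int_0^t v(\cdot,s)\,ds=v(\cdot,t)-\varphi$ for all $t\ge 0$. Let $x\in\mathbb R^N$ be such that $v(x,t)\ge 0$ for all $t>0$ and $v(x,\cdot)\in L^1(0,\infty)$. Let $\mathbf S=(\mathbf S_t)_{t\ge 0}$ be a subordinator without drift and killing, with L\'evy measure $\sigma$ on $(0,\infty)$, $\int_{(0,\infty)}(1\wedge\tau)\,\sigma(d\tau)<\infty$,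 so that $\mathbb E\,e^{-\lambda\mathbf S_t}=\exp\big(-t\int_{(0,\infty)}(1-e^{-\lambda\tau})\,\sigma(d\tau)\big)$ for $\lambda\ge0$. Let $\mathbf k(t)=\sigma((t,\infty))$ be the associated kernel, $\mathcal K(\lambda)=\int_0^\infty e^{-\lambda t}\mathbf k(t)\,dt$ its Laplace transform, $E_t=\inf\{s\ge 0:\mathbf S_s\ge t\}$ the inverse process and $G_t(\tau)$ the Lebesgue density of the law of $E_t$. Put $$v^E(x,t)=\int_0^\infty v(x,\tau)\,G_t(\tau)\,d\tau,\qquad \mathbf M_t(v^E(x,t))=\frac1t\int_0^t v^E(x,s)\,ds .$$ Assume that $\lambda\mathcal K(\lambda)\to 0$ as $\lambda\to 0^+$ and that, for some $\varrho\ge 0$, the function $L(y)=y^{-\varrho}\,\mathcal K(y^{-1})$ is slowly varying, i.e. $\lim_{y\to\infty}L(cy)/L(y)=1$ for every $c>0$. Then $$\mathbf M_t(v^E(x,t))\ \sim\ \frac{\|v(x,\cdot)\|_{L^1(0,\infty)}}{\Gamma(\varrho+1)}\;t^{-1}\,\mathcal K(t^{-1})\qquad\text{as }t\to\infty ,$$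 where $f\sim g$ means $f-g=o(g)$, equivalently $f/g\to 1$ when $g\neq0$ (so that if $\|v(x,\cdot)\|_{L^1(0,\infty)}=0$, the claim is that the left side vanishes for all large $t$). -/

import Mathlib

open MeasureTheory ProbabilityTheory Filter Set Topology Asymptotics
open scoped NNReal ENNReal

/-! ### The linear evolution equation -/

/-- The Banach space `L¹(ℝᴺ)` of real-valued functions, with Lebesgue measure. -/
abbrev L1Space (N : ℕ) : Type :=
  Lp ℝ 1 (volume : Measure (EuclideanSpace ℝ (Fin N)))

/-- A Markov operator on `L¹(ℝᴺ)`, in either of the two usual senses: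
* (backward, acting on observables) `0 ≤ f ≤ 1` implies `0 ≤ T f ≤ 1`;
* (forward, acting on densities) `f ≥ 0` implies `T f ≥ 0` and `∫ T f = ∫ f`. -/
def IsMarkovOperator {N : ℕ} (T : L1Space N →L[ℝ] L1Space N) : Prop :=
  (∀ f : L1Space N, (∀ᵐ x, 0 ≤ f x ∧ f x ≤ 1) → ∀ᵐ x, 0 ≤ T f x ∧ T f x ≤ 1) ∨
  (∀ f : L1Space N, (∀ᵐ x, 0 ≤ f x) → (∀ᵐ x, 0 ≤ T f x) ∧ ∫ x, T f x = ∫ x, f x)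

/-- A strongly continuous semigroup of Markov operators on `L¹(ℝᴺ)`. -/
structure IsMarkovSemigroup {N : ℕ} (T : ℝ≥0 → L1Space N →L[ℝ] L1Space N) : Prop where
  map_zero : T 0 = ContinuousLinearMap.id ℝ (L1Space N)
  map_add : ∀ s t, T (s + t) = (T s).comp (T t)
  continuous : ∀ f, Continuous fun t => T t f
  markov : ∀ t, IsMarkovOperator (T t)

/-- `A`, an unbounded operator on `L¹(ℝᴺ)`, is a Markov generator: it is the infinitesimal
generator of a Markov semigroup `T`, that is, `f ∈ D(A)` and `A f = g` if and only if
`(T h f - f) / h → g` in `L¹(ℝᴺ)` as `h → 0⁺`. -/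
def IsMarkovGenerator {N : ℕ} (A : L1Space N →ₗ.[ℝ] L1Space N) : Prop :=
  ∃ T : ℝ≥0 → L1Space N →L[ℝ] L1Space N, IsMarkovSemigroup T ∧
    ∀ f g : L1Space N, (f, g) ∈ A.graph ↔
      Tendsto (fun h : ℝ≥0 => (h : ℝ)⁻¹ • (T h f - f)) (𝓝[>] 0) (𝓝 g)

/-- `v` is a (mild) solution of the Cauchy problem `∂ₜ v = A v` in `ℝᴺ × (0, ∞)`,
`v(·, 0) = φ`: the curve `u(t) = v(·, t)` is continuous from `[0, ∞)` to `L¹(ℝᴺ)`, starts at `φ`,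
and for all `t ≥ 0` one has `∫₀ᵗ u(s) ds ∈ D(A)` and `A (∫₀ᵗ u(s) ds) = u(t) - u(0)`. -/
def IsSolution {N : ℕ} (A : L1Space N →ₗ.[ℝ] L1Space N)
    (φ : EuclideanSpace ℝ (Fin N) → ℝ) (v : EuclideanSpace ℝ (Fin N) → ℝ → ℝ) : Prop :=
  ∃ u : ℝ → L1Space N, ContinuousOn u (Ici 0) ∧ (u 0 =ᵐ[volume] φ) ∧
    (∀ t, 0 ≤ t → (∫ s in (0 : ℝ)..t, u s, u t - u 0) ∈ A.graph) ∧
    ∀ t, 0 ≤ t → (fun x => v x t) =ᵐ[volume] u t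

/-! ### Subordinators -/

/-- `σ` is the Lévy measure of a subordinator: a measure on `(0, ∞)` with
`∫ min(1, τ) σ(dτ) < ∞`. -/
structure IsSubordinatorLevyMeasure (σ : Measure ℝ) : Prop where
  support : σ (Iic 0) = 0
  lintegral_lt_top : ∫⁻ τ in Ioi 0, ENNReal.ofReal (min 1 τ) ∂σ < ∞

/-- `S` is a subordinator with Lévy measure `σ` (without drift and killing): it starts at `0`,
has independent and stationary increments and non-decreasing right-continuous paths, and its
Laplace exponent is `Φ(lam) = ∫_{(0, ∞)} (1 - e^{- lam τ}) σ(dτ)`. -/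
structure IsSubordinator {Ω : Type*} [MeasurableSpace Ω] (P : Measure Ω)
    (S : ℝ≥0 → Ω → ℝ) (σ : Measure ℝ) : Prop where
  measurable : ∀ t, Measurable (S t)
  start : ∀ᵐ ω ∂P, S 0 ω = 0
  paths : ∀ᵐ ω ∂P, Monotone (fun t => S t ω) ∧
    ∀ t, ContinuousWithinAt (fun s => S s ω) (Ici t) t
  indep : HasIndepIncrements S P
  stationary : ∀ t h, IdentDistrib (fun ω => S (t + h) ω - S t ω) (S h) P P
  levyMeasure : IsSubordinatorLevyMeasure σ
  laplace : ∀ (lam : ℝ), 0 ≤ lam → ∀ t : ℝ≥0,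
    ∫ ω, Real.exp (-lam * S t ω) ∂P =
      Real.exp (-t * ∫ τ in Ioi 0, (1 - Real.exp (-lam * τ)) ∂σ)

/-- The kernel `k(t) = σ((t, ∞))` attached to the Lévy measure `σ`. -/
noncomputable def levyKernel (σ : Measure ℝ) (t : ℝ) : ℝ := (σ (Ioi t)).toReal

/-- The Laplace transform `lam ↦ ∫₀^∞ e^{- lam t} f(t) dt`. -/
noncomputable def laplaceTransform (f : ℝ → ℝ) (lam : ℝ) : ℝ :=
  ∫ t in Ioi (0 : ℝ), Real.exp (-lam * t) * f t

/-- The inverse process `E_t = inf {s ≥ 0 : S_s ≥ t}`. -/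
noncomputable def inverseProcess {Ω : Type*} (S : ℝ≥0 → Ω → ℝ) (t : ℝ) (ω : Ω) : ℝ :=
  ((sInf {s : ℝ≥0 | t ≤ S s ω} : ℝ≥0) : ℝ)

/-- `G_t(τ)`, the Lebesgue density at `τ` of the law of `E_t`. -/
noncomputable def inverseDensity {Ω : Type*} [MeasurableSpace Ω] (P : Measure Ω)
    (S : ℝ≥0 → Ω → ℝ) (t τ : ℝ) : ℝ :=
  (pdf (inverseProcess S t) P volume τ).toReal

/-- The subordination `∫₀^∞ f(τ) G_t(τ) dτ` of `f` by the densities `G`. -/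
noncomputable def subordination (G : ℝ → ℝ → ℝ) (f : ℝ → ℝ) (t : ℝ) : ℝ :=
  ∫ τ in Ioi (0 : ℝ), f τ * G t τ

/-! ### Asymptotics -/

/-- The Cesàro mean `(1/t) ∫₀ᵗ f(s) ds`. -/
noncomputable def cesaroMean (f : ℝ → ℝ) (t : ℝ) : ℝ :=
  t⁻¹ * ∫ s in (0 : ℝ)..t, f s

/-- `L` is slowly varying at infinity: `L(c x) / L(x) → 1` as `x → ∞`, for every `c > 0`. -/
def IsSlowlyVarying (L : ℝ → ℝ) : Prop :=
  ∀ c : ℝ, 0 < c → Tendsto (fun x => L (c * x) / L x) atTop (𝓝 1)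

/-!
Write `f = v(x, ·)`, let `Φ(lam) = lam K(lam)` be the Laplace exponent of the subordinator, and
let `E` be its inverse. Everything is read off from Laplace transforms in the time variable.

For fixed `u`, the function `g(t, u) = E[σ((t - S_u, ∞)); S_u < t]` has Laplace transform
`K(lam) e^{- u Φ(lam)}` in `t`, while `P(E_t > τ) = P(S_τ < t)` has Laplace transform
`e^{- τ Φ(lam)} / lam = ∫_τ^∞ K(lam) e^{- u Φ(lam)} du`. By uniqueness of Laplace transforms, `E_t`
has density `g(t, ·)` for almost every `t > 0` (`ae_map_inverseProcess_eq_withDensity`), and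
almost every `t` is all that the Cesàro mean sees. Hence the subordination of `f` has the Laplace
transform `K(lam) ∫₀^∞ f(u) e^{- u Φ(lam)} du`, which is asymptotic to `‖f‖₁ K(lam)` as `lam → 0⁺`,
because `Φ(lam) → 0`. It varies regularly with index `-ρ`, and the claim is Karamata's Tauberian
theorem (`tendsto_measureReal_Iic_div_laplace`).

Karamata's theorem and the uniqueness theorem both rest on the moment method on `[0, 1]`
(`tendsto_integral_of_tendsto_moments`): under `s ↦ e^{- lam s}` the values of a Laplace transform
at the multiples of `lam` become moments. In Karamata's theorem the limiting moments
`(n + 1) ^ (-ρ)` are those of the image of a Gamma distribution, and the discontinuous integrand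
`y⁻¹ 1_{y ≥ 1/e}`, which recovers `U[0, 1 / lam]`, is squeezed between continuous ramps.
-/

/-! ### The moment method on the unit interval -/

theorem integrable_of_continuous_of_ae_mem_Icc {m : Measure ℝ} [IsFiniteMeasure m]
    (hm : ∀ᵐ y ∂m, y ∈ Icc (0 : ℝ) 1) {h : ℝ → ℝ} (hh : Continuous h) : Integrable h m := by
  obtain ⟨C, hC⟩ := isCompact_Icc.exists_bound_of_continuousOn (hh.continuousOn (s := Icc 0 1))
  exact Integrable.of_bound hh.aestronglyMeasurable C (hm.mono hC)

/-- Convergence of all moments of finite measures on `[0, 1]` implies convergence of the integrals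
of continuous functions, by Weierstrass approximation. -/
theorem tendsto_integral_of_tendsto_moments {ι : Type*} {l : Filter ι} {m : ι → Measure ℝ}
    {m₀ : Measure ℝ} [IsFiniteMeasure m₀] (hfin : ∀ᶠ i in l, IsFiniteMeasure (m i))
    (hm : ∀ᶠ i in l, ∀ᵐ y ∂m i, y ∈ Icc (0 : ℝ) 1) (hm₀ : ∀ᵐ y ∂m₀, y ∈ Icc (0 : ℝ) 1)
    (hmom : ∀ n : ℕ, Tendsto (fun i => ∫ y, y ^ n ∂m i) l (𝓝 (∫ y, y ^ n ∂m₀)))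
    {h : ℝ → ℝ} (hh : Continuous h) :
    Tendsto (fun i => ∫ y, h y ∂m i) l (𝓝 (∫ y, h y ∂m₀)) := by
  have hpoly : ∀ p : Polynomial ℝ,
      Tendsto (fun i => ∫ y, p.eval y ∂m i) l (𝓝 (∫ y, p.eval y ∂m₀)) := by
    intro p
    have key : ∀ μ : Measure ℝ, IsFiniteMeasure μ → (∀ᵐ y ∂μ, y ∈ Icc (0 : ℝ) 1) →
        ∫ y, p.eval y ∂μ = ∑ i ∈ Finset.range (p.natDegree + 1), p.coeff i * ∫ y, y ^ i ∂μ := by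
      intro μ _ hμ
      simp_rw [Polynomial.eval_eq_sum_range]
      rw [integral_finsetSum _ fun i _ =>
        integrable_of_continuous_of_ae_mem_Icc hμ (by fun_prop)]
      simp_rw [integral_const_mul]
    rw [key m₀ inferInstance hm₀]
    refine Tendsto.congr' ?_ (tendsto_finsetSum _ fun i _ => (hmom i).const_mul (p.coeff i))
    filter_upwards [hfin, hm] with i h1 h2 using (key _ h1 h2).symm
  have happrox : ∀ p : Polynomial ℝ, ∀ δ : ℝ, (∀ y ∈ Icc (0 : ℝ) 1, |p.eval y - h y| < δ) →
      ∀ μ : Measure ℝ, IsFiniteMeasure μ → (∀ᵐ y ∂μ, y ∈ Icc (0 : ℝ) 1) →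
      |∫ y, p.eval y ∂μ - ∫ y, h y ∂μ| ≤ δ * μ.real univ := by
    intro p δ hp μ _ hμ
    rw [← integral_sub (integrable_of_continuous_of_ae_mem_Icc hμ p.continuous)
      (integrable_of_continuous_of_ae_mem_Icc hμ hh)]
    refine norm_integral_le_of_norm_le_const (μ := μ) (f := fun y => p.eval y - h y) ?_
    exact hμ.mono fun y hy => (hp y hy).le
  have hmass : Tendsto (fun i => (m i).real univ) l (𝓝 (m₀.real univ)) := by
    simpa using hmom 0
  rw [Metric.tendsto_nhds]
  intro ε hε
  set M := m₀.real univ with hM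
  have hM0 : 0 ≤ M := measureReal_nonneg
  set δ := ε / (4 * (M + 1)) with hδ
  have hδ0 : 0 < δ := by positivity
  have hδε : δ * (M + 1) = ε / 4 := by rw [hδ]; field_simp
  obtain ⟨p, hp⟩ := exists_polynomial_near_of_continuousOn 0 1 h hh.continuousOn δ hδ0
  filter_upwards [hfin, hm, hmass.eventually (gt_mem_nhds (lt_add_one M)),
    Metric.tendsto_nhds.1 (hpoly p) (ε / 2) (by positivity)] with i h1 h2 h3 h4
  have h5 := happrox p δ hp _ h1 h2
  have h6 := happrox p δ hp m₀ inferInstance hm₀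
  have h7 : δ * (m i).real univ ≤ δ * (M + 1) := by gcongr
  rw [Real.dist_eq] at h4 ⊢
  rw [abs_le] at h5 h6
  rw [abs_lt] at h4 ⊢
  constructor <;> nlinarith

/-! ### Uniqueness of Laplace transforms -/

/-- A finite measure on `[0, ∞)` is determined by the values of its Laplace transform at the
natural numbers, which are the moments of its image under `x ↦ e^{-x}`. -/
theorem measure_eq_of_laplace_nat_eq {μ ν : Measure ℝ} [IsFiniteMeasure μ] [IsFiniteMeasure ν]
    (hμ : ∀ᵐ x ∂μ, 0 ≤ x) (hν : ∀ᵐ x ∂ν, 0 ≤ x)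
    (h : ∀ n : ℕ, ∫ x, Real.exp (-(n * x)) ∂μ = ∫ x, Real.exp (-(n * x)) ∂ν) : μ = ν := by
  have hmeas : Measurable fun x : ℝ => Real.exp (-x) := by fun_prop
  have hmem : ∀ κ : Measure ℝ, (∀ᵐ x ∂κ, 0 ≤ x) →
      ∀ᵐ y ∂κ.map (fun x => Real.exp (-x)), y ∈ Icc (0 : ℝ) 1 := by
    intro κ hκ
    refine (ae_map_iff hmeas.aemeasurable measurableSet_Icc).2 ?_
    exact hκ.mono fun x hx => ⟨(Real.exp_pos _).le, Real.exp_le_one_iff.2 (by linarith)⟩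
  have hmom : ∀ κ : Measure ℝ, ∀ n : ℕ,
      ∫ y, y ^ n ∂κ.map (fun x => Real.exp (-x)) = ∫ x, Real.exp (-(n * x)) ∂κ := by
    intro κ n
    rw [integral_map hmeas.aemeasurable (by fun_prop)]
    refine integral_congr_ae (.of_forall fun x => ?_)
    simp only
    rw [← Real.exp_nat_mul]
    ring_nf
  have hmap : μ.map (fun x => Real.exp (-x)) = ν.map (fun x => Real.exp (-x)) := by
    refine ext_of_forall_integral_eq_of_IsFiniteMeasure fun f => ?_
    have := tendsto_integral_of_tendsto_moments (l := (atTop : Filter ℕ))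
      (m := fun _ => μ.map (fun x => Real.exp (-x))) (m₀ := ν.map (fun x => Real.exp (-x)))
      (.of_forall fun _ => inferInstance) (.of_forall fun _ => hmem μ hμ) (hmem ν hν)
      (fun n => by simp_rw [hmom, h]; exact tendsto_const_nhds) f.continuous
    exact tendsto_nhds_unique tendsto_const_nhds this
  have hlog : Measurable fun y : ℝ => -Real.log y := by fun_prop
  have hid : (fun y : ℝ => -Real.log y) ∘ (fun x : ℝ => Real.exp (-x)) = id := by
    ext x; simp
  have := congrArg (fun κ : Measure ℝ => κ.map fun y : ℝ => -Real.log y) hmap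
  simpa only [Measure.map_map hlog hmeas, hid, Measure.map_id] using this

/-- Two functions on `(0, ∞)` with the same finite Laplace transform agree almost everywhere. -/
theorem ae_eq_of_lintegral_laplace_eq {a b : ℝ → ℝ≥0∞} (ha : Measurable a) (hb : Measurable b)
    (hab : ∀ lam : ℝ, 0 < lam →
      ∫⁻ t in Ioi 0, ENNReal.ofReal (Real.exp (-lam * t)) * a t =
        ∫⁻ t in Ioi 0, ENNReal.ofReal (Real.exp (-lam * t)) * b t)
    (hfin : ∫⁻ t in Ioi 0, ENNReal.ofReal (Real.exp (-1 * t)) * a t ≠ ∞) :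
    a =ᵐ[volume.restrict (Ioi 0)] b := by
  have hexp : ∀ lam : ℝ, Measurable fun t : ℝ => ENNReal.ofReal (Real.exp (-lam * t)) :=
    fun lam => by fun_prop
  -- The weight `e^{-t}` makes the two measures finite.
  set w : ℝ → ℝ≥0∞ := fun t => ENNReal.ofReal (Real.exp (-1 * t)) with hw
  have hwm : Measurable w := hexp 1
  have fin : ∀ c : ℝ → ℝ≥0∞, ∫⁻ t in Ioi 0, w t * c t ≠ ∞ →
      IsFiniteMeasure ((volume.restrict (Ioi 0)).withDensity (w * c)) :=
    fun c hc => isFiniteMeasure_withDensity hc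
  have pos : ∀ c : ℝ → ℝ≥0∞,
      ∀ᵐ x ∂(volume.restrict (Ioi 0)).withDensity (w * c), (0 : ℝ) ≤ x := by
    intro c
    refine (withDensity_absolutelyContinuous _ _).ae_le ?_
    exact (ae_restrict_mem measurableSet_Ioi).mono fun x hx => le_of_lt hx
  have lap : ∀ c : ℝ → ℝ≥0∞, Measurable c → ∀ n : ℕ,
      ∫ x, Real.exp (-(n * x)) ∂(volume.restrict (Ioi 0)).withDensity (w * c) =
        (∫⁻ t in Ioi 0, ENNReal.ofReal (Real.exp (-(n + 1 : ℝ) * t)) * c t).toReal := by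
    intro c hc n
    rw [integral_eq_lintegral_of_nonneg_ae (.of_forall fun _ => (Real.exp_pos _).le)
      (by fun_prop), lintegral_withDensity_eq_lintegral_mul _ (hwm.mul hc)
        (g := fun x => ENNReal.ofReal (Real.exp (-(n * x)))) (by fun_prop)]
    congr 1
    refine lintegral_congr fun t => ?_
    simp only [Pi.mul_apply, hw]
    rw [mul_right_comm, ← ENNReal.ofReal_mul (Real.exp_pos _).le, ← Real.exp_add]
    ring_nf
  have hfin' : ∫⁻ t in Ioi 0, w t * b t ≠ ∞ := hab 1 one_pos ▸ hfin
  have := fin a hfin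
  have := fin b hfin'
  have heq := measure_eq_of_laplace_nat_eq (pos a) (pos b) fun n => by
    rw [lap a ha, lap b hb, hab _ (by positivity)]
  rw [withDensity_eq_iff (hwm.mul ha).aemeasurable (hwm.mul hb).aemeasurable hfin] at heq
  filter_upwards [heq] with t ht
  exact (ENNReal.mul_right_inj (by simp [Real.exp_pos]) ENNReal.ofReal_ne_top).1 ht

/-! ### Karamata's Tauberian theorem -/

/-- A continuous function interpolating between `0` on `(-∞, a]` and `y ↦ y⁻¹` on `[b, ∞)`. -/
noncomputable def invRamp (a b y : ℝ) : ℝ :=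
  (max y a)⁻¹ * min 1 (max 0 ((y - a) / (b - a)))

section invRamp

variable {a b : ℝ}

theorem continuous_invRamp (ha : 0 < a) : Continuous (invRamp a b) := by
  unfold invRamp
  refine Continuous.mul (Continuous.inv₀ (by fun_prop) fun y => ?_) (by fun_prop)
  exact (lt_max_of_lt_right ha).ne'

theorem invRamp_nonneg (ha : 0 < a) (y : ℝ) : 0 ≤ invRamp a b y := by
  have : 0 < max y a := lt_max_of_lt_right ha
  unfold invRamp
  positivity

theorem invRamp_le_inv (ha : 0 < a) (y : ℝ) : invRamp a b y ≤ a⁻¹ := by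
  have : 0 < max y a := lt_max_of_lt_right ha
  calc invRamp a b y ≤ (max y a)⁻¹ * 1 := by
        unfold invRamp; gcongr; exact min_le_left _ _
    _ ≤ a⁻¹ := by rw [mul_one]; gcongr; exact le_max_right _ _

theorem invRamp_le_indicator (ha : 0 < a) (hab : a < b) (y : ℝ) :
    invRamp a b y ≤ (Ici a).indicator (·⁻¹) y := by
  by_cases hy : a ≤ y
  · rw [indicator_of_mem (mem_Ici.2 hy), invRamp, max_eq_left hy]
    exact mul_le_of_le_one_right (inv_nonneg.2 (ha.le.trans hy)) (min_le_left _ _)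
  · rw [indicator_of_notMem (by simpa using hy), invRamp, max_eq_left (a := (0 : ℝ))]
    · simp
    · exact div_nonpos_of_nonpos_of_nonneg (by linarith) (by linarith)

theorem indicator_le_invRamp (ha : 0 < a) (hab : a < b) (y : ℝ) :
    (Ici b).indicator (·⁻¹) y ≤ invRamp a b y := by
  by_cases hy : b ≤ y
  · rw [indicator_of_mem (mem_Ici.2 hy), invRamp, max_eq_left (hab.le.trans hy),
      max_eq_right (div_nonneg (by linarith) (by linarith)), min_eq_left, mul_one]
    rw [one_le_div (by linarith)]
    linarith
  · rw [indicator_of_notMem (by simpa using hy)]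
    exact invRamp_nonneg ha y

end invRamp

theorem integral_withDensity_gamma (ρ : ℝ) (f : ℝ → ℝ) (hρ : 0 < ρ) :
    ∫ x, f x ∂(volume.restrict (Ioi 0)).withDensity
        (fun x => ENNReal.ofReal ((Real.Gamma ρ)⁻¹ * (x ^ (ρ - 1) * Real.exp (-x)))) =
      (Real.Gamma ρ)⁻¹ * ∫ x in Ioi 0, f x * (x ^ (ρ - 1) * Real.exp (-x)) := by
  have hΓ : 0 < Real.Gamma ρ := Real.Gamma_pos_of_pos hρ
  rw [integral_withDensity_eq_integral_toReal_smul (by fun_prop)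
    (.of_forall fun _ => ENNReal.ofReal_lt_top), ← integral_const_mul]
  refine setIntegral_congr_fun measurableSet_Ioi fun x (hx : 0 < x) => ?_
  simp only [smul_eq_mul]
  rw [ENNReal.toReal_ofReal (by positivity)]
  ring

/-- The limit in Karamata's theorem: the image under `x ↦ e^{-x}` of the `Γ(ρ, 1)` distribution
(of the unit mass at `0` if `ρ = 0`). -/
theorem exists_karamata_limit {ρ : ℝ} (hρ : 0 ≤ ρ) :
    ∃ m₀ : Measure ℝ, IsFiniteMeasure m₀ ∧ (∀ᵐ y ∂m₀, y ∈ Icc (0 : ℝ) 1) ∧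
      (∀ n : ℕ, ∫ y, y ^ n ∂m₀ = (n + 1 : ℝ) ^ (-ρ)) ∧
      ∀ p : ℝ, 0 < p → ∫ y, (Ici (Real.exp (-p))).indicator (·⁻¹) y ∂m₀ =
        p ^ ρ / Real.Gamma (ρ + 1) := by
  rcases hρ.eq_or_lt with rfl | hρ
  · refine ⟨Measure.dirac 1, inferInstance, ?_, ?_, ?_⟩
    · rw [ae_dirac_eq]; simp
    · intro n; simp
    · intro p hp
      rw [integral_dirac, indicator_of_mem (by simpa using hp.le)]
      simp
  have hΓ : 0 < Real.Gamma ρ := Real.Gamma_pos_of_pos hρ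
  set γ : Measure ℝ := (volume.restrict (Ioi 0)).withDensity
    (fun x => ENNReal.ofReal ((Real.Gamma ρ)⁻¹ * (x ^ (ρ - 1) * Real.exp (-x)))) with hγ
  have hmeas : Measurable fun x : ℝ => Real.exp (-x) := by fun_prop
  have hγfin : IsFiniteMeasure γ := by
    refine isFiniteMeasure_withDensity_ofReal ?_
    have := ((Real.GammaIntegral_convergent hρ).const_mul (Real.Gamma ρ)⁻¹).2
    simpa only [mul_comm (Real.exp _)] using this
  have hγpos : ∀ᵐ x ∂γ, 0 < x :=
    (withDensity_absolutelyContinuous _ _).ae_le (ae_restrict_mem measurableSet_Ioi)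
  refine ⟨γ.map fun x => Real.exp (-x), inferInstance, ?_, fun n => ?_, fun p hp => ?_⟩
  · refine (ae_map_iff hmeas.aemeasurable measurableSet_Icc).2 ?_
    exact hγpos.mono fun x hx => ⟨(Real.exp_pos _).le, Real.exp_le_one_iff.2 (by linarith)⟩
  · rw [integral_map hmeas.aemeasurable (by fun_prop), hγ, integral_withDensity_gamma _ _ hρ]
    have : ∀ x : ℝ, Real.exp (-x) ^ n * (x ^ (ρ - 1) * Real.exp (-x)) =
        x ^ (ρ - 1) * Real.exp (-((n + 1 : ℝ) * x)) := by
      intro x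
      rw [← Real.exp_nat_mul, mul_left_comm, ← Real.exp_add]
      ring_nf
    simp_rw [this]
    rw [Real.integral_rpow_mul_exp_neg_mul_Ioi hρ (by positivity), one_div,
      Real.inv_rpow (by positivity), Real.rpow_neg (by positivity)]
    field_simp
  · have hind : Measurable ((Ici (Real.exp (-p))).indicator (·⁻¹ : ℝ → ℝ)) :=
      measurable_inv.indicator measurableSet_Ici
    rw [integral_map hmeas.aemeasurable hind.aestronglyMeasurable, hγ,
      integral_withDensity_gamma _ _ hρ]
    have : ∀ x : ℝ, (Ici (Real.exp (-p))).indicator (·⁻¹) (Real.exp (-x)) *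
        (x ^ (ρ - 1) * Real.exp (-x)) = (Iic p).indicator (fun x => x ^ (ρ - 1)) x := by
      intro x
      by_cases hx : x ≤ p
      · rw [indicator_of_mem (by simpa using hx), indicator_of_mem (by simpa using hx)]
        field_simp
      · rw [indicator_of_notMem (by simpa using hx), indicator_of_notMem (by simpa using hx),
          zero_mul]
    simp_rw [this]
    rw [setIntegral_indicator measurableSet_Iic, Ioi_inter_Iic,
      ← intervalIntegral.integral_of_le hp.le, integral_rpow (Or.inl (by linarith)),
      Real.Gamma_add_one hρ.ne', sub_add_cancel, Real.zero_rpow hρ.ne']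
    field_simp
    simp

/-- **Karamata's Tauberian theorem.** If the Laplace transform `ω` of a measure `U` on `[0, ∞)`
varies regularly at `0` with index `-ρ`, then `U [0, t] / ω (1 / t) → 1 / Γ (ρ + 1)`
as `t → ∞`. -/
theorem tendsto_measureReal_Iic_div_laplace {U : Measure ℝ} (hU : ∀ᵐ s ∂U, 0 ≤ s) {ρ : ℝ}
    (hρ : 0 ≤ ρ) {ω : ℝ → ℝ} (hω : ∀ lam, 0 < lam → ω lam = ∫ s, Real.exp (-lam * s) ∂U)
    (hint : ∀ lam, 0 < lam → Integrable (fun s => Real.exp (-lam * s)) U)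
    (hpos : ∀ lam, 0 < lam → 0 < ω lam)
    (hreg : ∀ c : ℝ, 0 < c → Tendsto (fun lam => ω (c * lam) / ω lam) (𝓝[>] 0) (𝓝 (c ^ (-ρ)))) :
    Tendsto (fun lam => U.real (Iic lam⁻¹) / ω lam) (𝓝[>] 0) (𝓝 (1 / Real.Gamma (ρ + 1))) := by
  obtain ⟨m₀, hm₀fin, hm₀, hmom₀, hF⟩ := exists_karamata_limit hρ
  have hmeas : ∀ lam : ℝ, Measurable fun s : ℝ => Real.exp (-lam * s) := fun lam => by fun_prop
  have hgt : ∀ᶠ lam : ℝ in 𝓝[>] 0, 0 < lam := eventually_mem_nhdsWithin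
  -- The probability measures to which the moment method applies.
  set m : ℝ → Measure ℝ := fun lam => ENNReal.ofReal (ω lam)⁻¹ •
    (U.withDensity fun s => ENNReal.ofReal (Real.exp (-lam * s))).map
      (fun s => Real.exp (-lam * s)) with hm_def
  have hm_int : ∀ lam, 0 < lam → ∀ h : ℝ → ℝ, Measurable h →
      ∫ y, h y ∂m lam =
        (∫ s, Real.exp (-lam * s) * h (Real.exp (-lam * s)) ∂U) / ω lam := by
    intro lam hlam h hh
    rw [hm_def, integral_smul_measure, integral_map (hmeas lam).aemeasurable
      hh.aestronglyMeasurable, integral_withDensity_eq_integral_toReal_smul (by fun_prop)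
      (.of_forall fun _ => ENNReal.ofReal_lt_top),
      ENNReal.toReal_ofReal (inv_nonneg.2 (hpos lam hlam).le), smul_eq_mul, inv_mul_eq_div]
    simp_rw [ENNReal.toReal_ofReal (Real.exp_pos _).le, smul_eq_mul]
  have hm_fin : ∀ᶠ lam in 𝓝[>] 0, IsFiniteMeasure (m lam) := by
    filter_upwards [hgt] with lam hlam
    have : IsFiniteMeasure (U.withDensity fun s => ENNReal.ofReal (Real.exp (-lam * s))) :=
      isFiniteMeasure_withDensity_ofReal (hint lam hlam).2
    exact Measure.smul_finite _ ENNReal.ofReal_ne_top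
  have hm_mem : ∀ᶠ lam in 𝓝[>] 0, ∀ᵐ y ∂m lam, y ∈ Icc (0 : ℝ) 1 := by
    filter_upwards [hgt] with lam hlam
    refine Measure.ae_smul_measure ?_ _
    refine (ae_map_iff (hmeas lam).aemeasurable measurableSet_Icc).2 ?_
    refine (withDensity_absolutelyContinuous _ _).ae_le (hU.mono fun s hs => ?_)
    exact ⟨(Real.exp_pos _).le, Real.exp_le_one_iff.2 (by nlinarith)⟩
  have hconv : ∀ {h : ℝ → ℝ}, Continuous h →
      Tendsto (fun lam => ∫ y, h y ∂m lam) (𝓝[>] 0) (𝓝 (∫ y, h y ∂m₀)) := by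
    intro h hh
    refine tendsto_integral_of_tendsto_moments hm_fin hm_mem hm₀ (fun n => ?_) hh
    rw [hmom₀]
    refine (hreg (n + 1) (by positivity)).congr' ?_
    filter_upwards [hgt] with lam hlam
    rw [hm_int lam hlam _ (by fun_prop), hω _ (by positivity)]
    congr 1
    refine integral_congr_ae (.of_forall fun s => ?_)
    simp only
    rw [← Real.exp_nat_mul, ← Real.exp_add]
    ring_nf
  -- `U [0, 1 / lam]` is `ω lam` times the integral of `y⁻¹` over `y ≥ e⁻¹`.
  have hind_eq : ∀ lam : ℝ, 0 < lam → ∀ s : ℝ, (Iic lam⁻¹).indicator (1 : ℝ → ℝ) s =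
      Real.exp (-lam * s) * (Ici (Real.exp (-1))).indicator (·⁻¹) (Real.exp (-lam * s)) := by
    intro lam hlam s
    have hiff : s ∈ Iic lam⁻¹ ↔ Real.exp (-lam * s) ∈ Ici (Real.exp (-1)) := by
      rw [mem_Iic, mem_Ici, Real.exp_le_exp, ← one_div, le_div_iff₀ hlam]
      constructor <;> intro h <;> linarith
    by_cases hs : s ∈ Iic lam⁻¹
    · rw [indicator_of_mem hs, indicator_of_mem (hiff.1 hs), Pi.one_apply,
        mul_inv_cancel₀ (Real.exp_pos _).ne']
    · rw [indicator_of_notMem hs, indicator_of_notMem (mt hiff.2 hs), mul_zero]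
  have hUreal : ∀ lam : ℝ, 0 < lam → U.real (Iic lam⁻¹) =
      ∫ s, (Iic lam⁻¹).indicator (1 : ℝ → ℝ) s ∂U := fun lam _ =>
    (integral_indicator_one measurableSet_Iic).symm
  have hbdd : ∀ lam : ℝ, 0 < lam → ∀ h : ℝ → ℝ, Measurable h → ∀ C : ℝ, (∀ y, 0 ≤ h y) →
      (∀ y, h y ≤ C) → Integrable (fun s => Real.exp (-lam * s) * h (Real.exp (-lam * s))) U := by
    intro lam hlam h hh C h0 hC
    refine (hint lam hlam).mul_bdd (c := C) (hh.comp (hmeas lam)).aestronglyMeasurable ?_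
    refine .of_forall fun s => ?_
    rw [Real.norm_of_nonneg (h0 _)]
    exact hC _
  have hind0 : ∀ {a : ℝ}, 0 < a → ∀ y : ℝ, 0 ≤ (Ici a).indicator (·⁻¹) y := fun {a} ha y =>
    indicator_nonneg (fun y (hy : a ≤ y) => inv_nonneg.2 (ha.le.trans hy)) y
  have hindC : ∀ {a : ℝ}, 0 < a → ∀ y : ℝ, (Ici a).indicator (·⁻¹) y ≤ a⁻¹ := fun {a} ha y =>
    indicator_le' (fun y (hy : a ≤ y) => by gcongr) (fun _ _ => inv_nonneg.2 ha.le) y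
  have hindm : ∀ a : ℝ, Measurable ((Ici a).indicator (·⁻¹ : ℝ → ℝ)) := fun a =>
    measurable_inv.indicator measurableSet_Ici
  have hindint : ∀ {a : ℝ}, 0 < a → Integrable ((Ici a).indicator (·⁻¹ : ℝ → ℝ)) m₀ := fun {a} ha =>
    Integrable.of_bound (hindm a).aestronglyMeasurable a⁻¹ <| .of_forall fun y => by
      rw [Real.norm_of_nonneg (hind0 ha y)]; exact hindC ha y
  have hrampint : ∀ {a b : ℝ}, 0 < a → Integrable (invRamp a b) m₀ := fun {a b} ha =>
    Integrable.of_bound (continuous_invRamp ha).aestronglyMeasurable a⁻¹ <| .of_forall fun y => by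
      rw [Real.norm_of_nonneg (invRamp_nonneg ha y)]; exact invRamp_le_inv ha y
  have hcont : Tendsto (fun p : ℝ => p ^ ρ / Real.Gamma (ρ + 1)) (𝓝 1)
      (𝓝 (1 / Real.Gamma (ρ + 1))) := by
    have := (Real.continuousAt_rpow_const 1 ρ (Or.inl one_ne_zero)).div_const (Real.Gamma (ρ + 1))
    simpa [ContinuousAt] using this
  have he : 0 < Real.exp (-1) := Real.exp_pos _
  rw [tendsto_order]
  constructor
  · intro c hc
    obtain ⟨p, hp1, hp0, hpc⟩ : ∃ p : ℝ, p < 1 ∧ 0 < p ∧ c < p ^ ρ / Real.Gamma (ρ + 1) := by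
      have h1 : ∀ᶠ p : ℝ in 𝓝[<] 1, c < p ^ ρ / Real.Gamma (ρ + 1) :=
        (hcont.mono_left nhdsWithin_le_nhds).eventually (lt_mem_nhds hc)
      have h2 : ∀ᶠ p : ℝ in 𝓝[<] 1, 0 < p := nhdsWithin_le_nhds (lt_mem_nhds one_pos)
      obtain ⟨p, h⟩ := (h1.and (h2.and eventually_mem_nhdsWithin)).exists
      exact ⟨p, h.2.2, h.2.1, h.1⟩
    have hlt : Real.exp (-1) < Real.exp (-p) := Real.exp_lt_exp.2 (by linarith)
    have hlim : c < ∫ y, invRamp (Real.exp (-1)) (Real.exp (-p)) y ∂m₀ := by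
      refine hpc.trans_le ?_
      rw [← hF p hp0]
      exact integral_mono (hindint (Real.exp_pos _)) (hrampint he) (indicator_le_invRamp he hlt)
    filter_upwards [hgt, (hconv (continuous_invRamp he)).eventually (lt_mem_nhds hlim)]
      with lam hlam h
    refine h.trans_le ?_
    rw [hm_int lam hlam _ (continuous_invRamp he).measurable, hUreal lam hlam]
    simp_rw [hind_eq lam hlam]
    refine div_le_div_of_nonneg_right ?_ (hpos lam hlam).le
    refine integral_mono (hbdd lam hlam _ (continuous_invRamp he).measurable _
      (invRamp_nonneg he) (invRamp_le_inv he)) (hbdd lam hlam _ (hindm _) _ (hind0 he)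
      (hindC he)) fun s => ?_
    exact mul_le_mul_of_nonneg_left (invRamp_le_indicator he hlt _) (Real.exp_pos _).le
  · intro c hc
    obtain ⟨p, hp1, hpc⟩ : ∃ p : ℝ, 1 < p ∧ p ^ ρ / Real.Gamma (ρ + 1) < c := by
      have h1 : ∀ᶠ p : ℝ in 𝓝[>] 1, p ^ ρ / Real.Gamma (ρ + 1) < c :=
        (hcont.mono_left nhdsWithin_le_nhds).eventually (gt_mem_nhds hc)
      obtain ⟨p, h⟩ := (h1.and eventually_mem_nhdsWithin).exists
      exact ⟨p, h.2, h.1⟩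
    have hp : 0 < Real.exp (-p) := Real.exp_pos _
    have hlt : Real.exp (-p) < Real.exp (-1) := Real.exp_lt_exp.2 (by linarith)
    have hlim : ∫ y, invRamp (Real.exp (-p)) (Real.exp (-1)) y ∂m₀ < c := by
      refine lt_of_le_of_lt ?_ hpc
      rw [← hF p (by linarith)]
      exact integral_mono (hrampint hp) (hindint hp) (invRamp_le_indicator hp hlt)
    filter_upwards [hgt, (hconv (continuous_invRamp hp)).eventually (gt_mem_nhds hlim)]
      with lam hlam h
    refine lt_of_le_of_lt ?_ h
    rw [hm_int lam hlam _ (continuous_invRamp hp).measurable, hUreal lam hlam]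
    simp_rw [hind_eq lam hlam]
    refine div_le_div_of_nonneg_right ?_ (hpos lam hlam).le
    refine integral_mono (hbdd lam hlam _ (hindm _) _ (hind0 he) (hindC he))
      (hbdd lam hlam _ (continuous_invRamp hp).measurable _ (invRamp_nonneg hp)
        (invRamp_le_inv hp)) fun s => ?_
    exact mul_le_mul_of_nonneg_left (indicator_le_invRamp hp hlt _) (Real.exp_pos _).le

/-! ### The kernel of a Lévy measure -/

/-- The Laplace transform of the kernel `s ↦ σ((s, ∞))`, with values in `[0, ∞]`. -/
noncomputable def kernelLaplace (σ : Measure ℝ) (lam : ℝ) : ℝ≥0∞ :=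
  ∫⁻ s in Ioi 0, ENNReal.ofReal (Real.exp (-lam * s)) * σ (Ioi s)

/-- The Laplace exponent `lam ↦ ∫ (1 - e^{- lam τ}) σ(dτ)`. -/
noncomputable def laplaceExponent (σ : Measure ℝ) (lam : ℝ) : ℝ :=
  ∫ τ in Ioi 0, (1 - Real.exp (-lam * τ)) ∂σ

theorem measurable_measure_Ioi (σ : Measure ℝ) : Measurable fun s => σ (Ioi s) :=
  Antitone.measurable fun _ _ h => measure_mono (Ioi_subset_Ioi h)

theorem one_sub_exp_nonneg {lam τ : ℝ} (hlam : 0 ≤ lam) (hτ : 0 ≤ τ) :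
    0 ≤ 1 - Real.exp (-lam * τ) :=
  sub_nonneg.2 (Real.exp_le_one_iff.2 (by nlinarith))

/-- Integration by parts, `∫ (1 - e^{- lam τ}) σ(dτ) = lam ∫₀^∞ e^{- lam s} σ((s, ∞)) ds`, as an
instance of the layer cake formula. -/
theorem lintegral_one_sub_exp_eq (σ : Measure ℝ) {lam : ℝ} (hlam : 0 < lam) :
    ∫⁻ τ in Ioi 0, ENNReal.ofReal (1 - Real.exp (-lam * τ)) ∂σ =
      ENNReal.ofReal lam * kernelLaplace σ lam := by
  have hint : ∀ τ : ℝ, ∫ s in (0 : ℝ)..τ, lam * Real.exp (-lam * s) =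
      1 - Real.exp (-lam * τ) := by
    intro τ
    have hd : ∀ s ∈ uIcc 0 τ, HasDerivAt (fun s => -Real.exp (-lam * s))
        (lam * Real.exp (-lam * s)) s := by
      intro s _
      have := (((hasDerivAt_id s).const_mul (-lam)).exp).neg
      simp only [id, mul_one] at this
      exact this.congr_deriv (by ring)
    rw [intervalIntegral.integral_eq_sub_of_hasDerivAt hd
      (Continuous.intervalIntegrable (by fun_prop) _ _)]
    simp
    ring
  have := lintegral_comp_eq_lintegral_meas_lt_mul (σ.restrict (Ioi 0)) (f := id)
    (g := fun s => lam * Real.exp (-lam * s))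
    ((ae_restrict_mem measurableSet_Ioi).mono fun τ hτ => le_of_lt hτ) aemeasurable_id
    (fun t _ => Continuous.intervalIntegrable (by fun_prop) _ _)
    (.of_forall fun t => by positivity)
  simp only [id, hint] at this
  rw [this, kernelLaplace, ← lintegral_const_mul' _ _ ENNReal.ofReal_ne_top]
  refine setLIntegral_congr_fun measurableSet_Ioi fun s (hs : 0 < s) => ?_
  have hset : {a : ℝ | s < a} = Ioi s := rfl
  rw [hset, Measure.restrict_apply measurableSet_Ioi, Ioi_inter_Ioi, max_eq_left hs.le,
    ENNReal.ofReal_mul hlam.le]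
  ring

namespace IsSubordinatorLevyMeasure

variable {σ : Measure ℝ}

theorem measure_Ioi_ne_top (hσ : IsSubordinatorLevyMeasure σ) {s : ℝ} (hs : 0 < s) :
    σ (Ioi s) ≠ ∞ := by
  have h1 : 0 < min 1 s := lt_min one_pos hs
  have h2 : ENNReal.ofReal (min 1 s) * σ (Ioi s) ≤ ∫⁻ τ in Ioi 0, ENNReal.ofReal (min 1 τ) ∂σ :=
    calc ENNReal.ofReal (min 1 s) * σ (Ioi s)
        = ∫⁻ _ in Ioi s, ENNReal.ofReal (min 1 s) ∂σ := by simp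
      _ ≤ ∫⁻ τ in Ioi s, ENNReal.ofReal (min 1 τ) ∂σ :=
          setLIntegral_mono (by fun_prop) fun τ (hτ : s < τ) => by gcongr
      _ ≤ _ := lintegral_mono_set (Ioi_subset_Ioi hs.le)
  intro h
  rw [h, ENNReal.mul_top (by simpa using hs)] at h2
  exact absurd (h2.trans_lt hσ.lintegral_lt_top) (lt_irrefl _)

theorem lintegral_one_sub_exp_ne_top (hσ : IsSubordinatorLevyMeasure σ) (lam : ℝ) :
    ∫⁻ τ in Ioi 0, ENNReal.ofReal (1 - Real.exp (-lam * τ)) ∂σ ≠ ∞ := by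
  have hle : ∫⁻ τ in Ioi 0, ENNReal.ofReal (1 - Real.exp (-lam * τ)) ∂σ ≤
      ∫⁻ τ in Ioi 0, ENNReal.ofReal (max 1 lam) * ENNReal.ofReal (min 1 τ) ∂σ := by
    refine setLIntegral_mono (by fun_prop) fun τ (hτ : 0 < τ) => ?_
    rw [← ENNReal.ofReal_mul (by positivity)]
    refine ENNReal.ofReal_le_ofReal ?_
    have h1 := Real.add_one_le_exp (-lam * τ)
    have h2 := Real.exp_pos (-lam * τ)
    rcases le_total 1 τ with h | h
    · rw [min_eq_left h]
      linarith [le_max_left 1 lam]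
    · rw [min_eq_right h]
      nlinarith [le_max_right 1 lam]
  refine ne_top_of_le_ne_top ?_ hle
  rw [lintegral_const_mul' _ _ ENNReal.ofReal_ne_top]
  exact ENNReal.mul_ne_top ENNReal.ofReal_ne_top hσ.lintegral_lt_top.ne

theorem kernelLaplace_ne_top (hσ : IsSubordinatorLevyMeasure σ) {lam : ℝ} (hlam : 0 < lam) :
    kernelLaplace σ lam ≠ ∞ := by
  intro h
  have := lintegral_one_sub_exp_eq σ hlam
  rw [h, ENNReal.mul_top (by simpa using hlam)] at this
  exact hσ.lintegral_one_sub_exp_ne_top lam this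

theorem laplaceTransform_levyKernel (hσ : IsSubordinatorLevyMeasure σ) (lam : ℝ) :
    laplaceTransform (levyKernel σ) lam = (kernelLaplace σ lam).toReal := by
  have hm := measurable_measure_Ioi σ
  rw [laplaceTransform, kernelLaplace, integral_eq_lintegral_of_nonneg_ae (f := fun s =>
      Real.exp (-lam * s) * levyKernel σ s)
    (.of_forall fun s => mul_nonneg (Real.exp_pos _).le ENNReal.toReal_nonneg)
    (Measurable.aestronglyMeasurable (Measurable.mul (by fun_prop) hm.ennreal_toReal))]
  congr 1
  refine setLIntegral_congr_fun measurableSet_Ioi fun s hs => ?_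
  simp only [levyKernel]
  rw [ENNReal.ofReal_mul (Real.exp_pos _).le, ENNReal.ofReal_toReal (hσ.measure_Ioi_ne_top hs)]

end IsSubordinatorLevyMeasure

theorem laplaceExponent_eq (σ : Measure ℝ) {lam : ℝ} (hlam : 0 < lam) :
    laplaceExponent σ lam = lam * (kernelLaplace σ lam).toReal := by
  rw [laplaceExponent, integral_eq_lintegral_of_nonneg_ae
    ((ae_restrict_mem measurableSet_Ioi).mono fun τ hτ => one_sub_exp_nonneg hlam.le (le_of_lt hτ))
    (by fun_prop), lintegral_one_sub_exp_eq σ hlam, ENNReal.toReal_mul,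
    ENNReal.toReal_ofReal hlam.le]

/-- The Laplace transform of the kernel vanishes somewhere only if it vanishes everywhere. -/
theorem kernelLaplace_ne_zero {σ : Measure ℝ} {lam₀ : ℝ} (h : kernelLaplace σ lam₀ ≠ 0)
    (lam : ℝ) : kernelLaplace σ lam ≠ 0 := by
  have hm := measurable_measure_Ioi σ
  have hiff : ∀ c : ℝ, kernelLaplace σ c = 0 ↔
      (fun s => σ (Ioi s)) =ᵐ[volume.restrict (Ioi 0)] 0 := by
    intro c
    rw [kernelLaplace, lintegral_eq_zero_iff
      (f := fun s => ENNReal.ofReal (Real.exp (-c * s)) * σ (Ioi s))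
      (Measurable.mul (by fun_prop) hm)]
    refine eventually_congr (.of_forall fun s => ?_)
    simp [Real.exp_pos]
  rwa [Ne, hiff, ← hiff lam₀]

/-! ### Paths of a subordinator and their inverses -/

/-- A path of a subordinator, without exceptional behaviour: it starts at `0`, is non-decreasing,
right-continuous and unbounded. -/
structure IsSubordinatorPath (f : ℝ≥0 → ℝ) : Prop where
  map_zero : f 0 = 0
  monotone : Monotone f
  rightContinuous : ∀ t, ContinuousWithinAt f (Ici t) t
  unbounded : ∀ c, ∃ t, c ≤ f t

theorem IsSubordinatorPath.nonneg {f : ℝ≥0 → ℝ} (hf : IsSubordinatorPath f) (t : ℝ≥0) :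
    0 ≤ f t := hf.map_zero ▸ hf.monotone (zero_le)

theorem lt_inverseProcess_iff {Ω : Type*} {S : ℝ≥0 → Ω → ℝ} {ω : Ω}
    (hf : IsSubordinatorPath fun s => S s ω) (t : ℝ) (τ : ℝ≥0) :
    (τ : ℝ) < inverseProcess S t ω ↔ S τ ω < t := by
  rw [inverseProcess, NNReal.coe_lt_coe]
  set A : Set ℝ≥0 := {s : ℝ≥0 | t ≤ S s ω} with hA
  have hmem : sInf A ∈ A := by
    have h1 : sInf A ∈ closure A := csInf_mem_closure (hf.unbounded t) (OrderBot.bddBelow _)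
    exact ContinuousWithinAt.closure_le (f := fun _ => t) (g := fun s => S s ω) h1
      continuousWithinAt_const
      ((hf.rightContinuous (sInf A)).mono fun s hs => csInf_le (OrderBot.bddBelow _) hs)
      fun s hs => hs
  constructor
  · intro h
    by_contra! h'
    exact absurd (csInf_le (OrderBot.bddBelow A) (show τ ∈ A from h')) (not_le.2 h)
  · intro h
    by_contra! h'
    exact absurd (h.trans_le (hmem.trans (hf.monotone h'))) (lt_irrefl _)

theorem measurable_inverseProcess {Ω : Type*} [MeasurableSpace Ω] {S : ℝ≥0 → Ω → ℝ}
    (hS : ∀ t, Measurable (S t)) (hpath : ∀ ω, IsSubordinatorPath fun s => S s ω) (t : ℝ) :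
    Measurable (inverseProcess S t) := by
  refine measurable_of_Ioi fun c => ?_
  rcases le_or_gt 0 c with hc | hc
  · lift c to ℝ≥0 using hc
    have : inverseProcess S t ⁻¹' Ioi (c : ℝ) = {ω | S c ω < t} := by
      ext ω; exact lt_inverseProcess_iff (hpath ω) t c
    rw [this]
    exact measurableSet_lt (hS c) measurable_const
  · have : inverseProcess S t ⁻¹' Ioi c = univ := by
      ext ω; exact iff_of_true (hc.trans_le (NNReal.coe_nonneg _)) trivial
    rw [this]
    exact MeasurableSet.univ

/-- A process with right-continuous paths is jointly measurable, as the limit of its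
discretizations at the grid points `(⌊n u⌋ + 1) / n`, which approach `u` from the right. -/
theorem measurable_uncurry_of_rightContinuous {Ω : Type*} [MeasurableSpace Ω] {S : ℝ≥0 → Ω → ℝ}
    (hS : ∀ t, Measurable (S t)) (hcont : ∀ ω t, ContinuousWithinAt (fun s => S s ω) (Ici t) t) :
    Measurable (Function.uncurry S) := by
  set d : ℕ → ℝ≥0 → ℝ≥0 := fun n u => (⌊(n + 1 : ℝ≥0) * u⌋₊ + 1 : ℝ≥0) / (n + 1) with hd
  have hle : ∀ n u, u ≤ d n u := by
    intro n u
    rw [hd, le_div_iff₀ (by positivity), mul_comm]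
    exact (Nat.lt_floor_add_one _).le
  have hge : ∀ n u, d n u ≤ u + 1 / ((n : ℝ≥0) + 1) := by
    intro n u
    have : ((⌊(n + 1 : ℝ≥0) * u⌋₊ : ℝ≥0)) ≤ (n + 1 : ℝ≥0) * u := Nat.floor_le (zero_le)
    rw [hd, div_le_iff₀ (by positivity)]
    calc _ ≤ (n + 1 : ℝ≥0) * u + 1 := by gcongr
      _ = _ := by field_simp
  have htend : ∀ u, Tendsto (fun n => d n u) atTop (𝓝[≥] u) := by
    intro u
    refine tendsto_nhdsWithin_iff.2 ⟨?_, .of_forall fun n => hle n u⟩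
    refine tendsto_of_tendsto_of_tendsto_of_le_of_le tendsto_const_nhds ?_ (fun n => hle n u)
      (fun n => hge n u)
    have := tendsto_one_div_add_atTop_nhds_zero_nat (𝕜 := ℝ≥0)
    simpa using this.const_add u
  refine measurable_of_tendsto_metrizable
    (f := fun n p => S (d n p.1) p.2) (fun n => ?_) (tendsto_pi_nhds.2 fun p => ?_)
  · clear htend hge hle
    have h1 : Measurable fun q : ℕ × Ω => S ((q.1 + 1 : ℝ≥0) / (n + 1)) q.2 :=
      measurable_from_prod_countable_right fun k => hS ((k + 1) / (n + 1))
    have h2 : Measurable fun p : ℝ≥0 × Ω => (⌊(n + 1 : ℝ≥0) * p.1⌋₊, p.2) :=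
      (Nat.measurable_floor.comp (by fun_prop)).prodMk measurable_snd
    have h3 := h1.comp h2
    simpa only [hd, Function.comp_def] using h3
  · exact (hcont p.2 p.1).tendsto.comp (htend p.1)

section LaplaceSubordinator

variable {Ω : Type*} [MeasurableSpace Ω] {P : Measure Ω} {S : ℝ≥0 → Ω → ℝ} {σ : Measure ℝ}

theorem IsSubordinator.lintegral_laplace (hS : IsSubordinator P S σ) {lam : ℝ} (hlam : 0 ≤ lam)
    (t : ℝ≥0) : ∫⁻ ω, ENNReal.ofReal (Real.exp (-lam * S t ω)) ∂P =
      ENNReal.ofReal (Real.exp (-t * laplaceExponent σ lam)) := by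
  have h := hS.laplace lam hlam t
  rw [laplaceExponent, ← h, ofReal_integral_eq_lintegral_ofReal _
    (.of_forall fun _ => (Real.exp_pos _).le)]
  -- The integral is an exponential, hence nonzero, so it is not the junk value.
  exact Integrable.of_integral_ne_zero (h ▸ (Real.exp_pos _).ne')

/-- The paths of a subordinator with nonzero Laplace exponent are almost surely unbounded, by
Chernoff's bound. -/
theorem IsSubordinator.ae_unbounded (hS : IsSubordinator P S σ) {lam : ℝ} (hlam : 0 < lam)
    (hΦ : 0 < laplaceExponent σ lam) : ∀ᵐ ω ∂P, ∀ c : ℝ, ∃ t, c ≤ S t ω := by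
  have key : ∀ k : ℕ, ∀ᵐ ω ∂P, ∃ t, (k : ℝ) ≤ S t ω := by
    intro k
    rw [ae_iff]
    set w : ℝ≥0∞ := ENNReal.ofReal (Real.exp (-lam * k)) with hw
    have hbound : ∀ n : ℕ, w * P {ω | ¬∃ t, (k : ℝ) ≤ S t ω} ≤
        ENNReal.ofReal (Real.exp (-n * laplaceExponent σ lam)) := by
      intro n
      have h1 := hS.lintegral_laplace hlam.le (n : ℝ≥0)
      rw [NNReal.coe_natCast] at h1
      rw [← h1]
      have h2 := hS.measurable (n : ℝ≥0)
      refine le_trans ?_ (mul_meas_ge_le_lintegral₀ (by fun_prop) w)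
      refine mul_le_mul' le_rfl (measure_mono fun ω hω => ?_)
      simp only [not_exists, not_le, mem_ofPred_eq] at hω ⊢
      exact ENNReal.ofReal_le_ofReal (Real.exp_le_exp.2 (by nlinarith [hω (n : ℝ≥0)]))
    have hlim : Tendsto (fun n : ℕ => ENNReal.ofReal (Real.exp (-n * laplaceExponent σ lam)))
        atTop (𝓝 0) := by
      rw [← ENNReal.ofReal_zero]
      refine ENNReal.tendsto_ofReal (Real.tendsto_exp_neg_atTop_nhds_zero.comp
        (tendsto_natCast_atTop_atTop.atTop_mul_const hΦ) |>.congr fun n => ?_)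
      simp
    have h0 : w * P {ω | ¬∃ t, (k : ℝ) ≤ S t ω} = 0 :=
      le_antisymm (ge_of_tendsto' hlim hbound) (zero_le)
    refine (mul_eq_zero.1 h0).resolve_left ?_
    simp [hw, Real.exp_pos]
  filter_upwards [ae_all_iff.2 key] with ω h c
  obtain ⟨k, hk⟩ := exists_nat_ge c
  obtain ⟨t, ht⟩ := h k
  exact ⟨t, hk.trans ht⟩

/-- A subordinator with nonzero Laplace exponent has a version all of whose paths are regular. -/
theorem IsSubordinator.exists_version (hS : IsSubordinator P S σ) {lam : ℝ} (hlam : 0 < lam)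
    (hΦ : 0 < laplaceExponent σ lam) :
    ∃ S' : ℝ≥0 → Ω → ℝ, (∀ t, Measurable (S' t)) ∧
      (∀ ω, IsSubordinatorPath fun t => S' t ω) ∧ ∀ᵐ ω ∂P, ∀ t, S' t ω = S t ω := by
  classical
  have hgood : ∀ᵐ ω ∂P, IsSubordinatorPath fun t => S t ω := by
    filter_upwards [hS.start, hS.paths, hS.ae_unbounded hlam hΦ] with ω h0 hp hu
    exact ⟨h0, hp.1, hp.2, hu⟩
  obtain ⟨Z, hZ, hZm, hZ0⟩ := exists_measurable_superset_of_null (ae_iff.1 hgood)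
  -- On the exceptional set the paths are replaced by the identity.
  refine ⟨fun t => Z.piecewise (fun _ => (t : ℝ)) (S t),
    fun t => Measurable.piecewise hZm measurable_const (hS.measurable t), fun ω => ?_, ?_⟩
  · by_cases hω : ω ∈ Z
    · simp only [piecewise_eq_of_mem _ _ _ hω]
      refine ⟨rfl, NNReal.coe_mono, fun t => NNReal.continuous_coe.continuousWithinAt,
        fun c => ⟨c.toNNReal, Real.le_coe_toNNReal c⟩⟩
    · simp only [piecewise_eq_of_notMem _ _ _ hω]
      by_contra h
      exact hω (hZ h)
  · have : ∀ᵐ ω ∂P, ω ∉ Z := by rw [ae_iff]; simpa using hZ0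
    filter_upwards [this] with ω hω t
    exact piecewise_eq_of_notMem _ _ _ hω

end LaplaceSubordinator

/-! ### The density of the inverse process -/

/-- Shifting a function on `(0, ∞)` to the right by `c ≥ 0` multiplies its Laplace transform by
`e^{- lam c}`. -/
theorem lintegral_laplace_shift (h : ℝ → ℝ≥0∞) (lam : ℝ) {c : ℝ} (hc : 0 ≤ c) :
    ∫⁻ t in Ioi 0, ENNReal.ofReal (Real.exp (-lam * t)) * (Ioi 0).indicator h (t - c) =
      ENNReal.ofReal (Real.exp (-lam * c)) *
        ∫⁻ t in Ioi 0, ENNReal.ofReal (Real.exp (-lam * t)) * h t := by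
  rw [← lintegral_const_mul' _ _ ENNReal.ofReal_ne_top, ← lintegral_indicator measurableSet_Ioi,
    ← lintegral_indicator measurableSet_Ioi, ← lintegral_add_right_eq_self _ c]
  refine lintegral_congr fun t => ?_
  by_cases ht : t ∈ Ioi (0 : ℝ)
  · have ht' : t + c ∈ Ioi (0 : ℝ) := add_pos_of_pos_of_nonneg ht hc
    rw [indicator_of_mem ht, indicator_of_mem ht', add_sub_cancel_right, indicator_of_mem ht,
      ← mul_assoc, ← ENNReal.ofReal_mul (Real.exp_pos _).le, ← Real.exp_add]
    ring_nf
  · rw [indicator_of_notMem ht]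
    by_cases ht' : t + c ∈ Ioi (0 : ℝ)
    · rw [indicator_of_mem ht', add_sub_cancel_right, indicator_of_notMem ht, mul_zero]
    · rw [indicator_of_notMem ht']

theorem lintegral_laplace_shift_process {Ω : Type*} [MeasurableSpace Ω] {P : Measure Ω}
    [SFinite P] {X : Ω → ℝ} (hX : Measurable X) (hX0 : ∀ ω, 0 ≤ X ω) {h : ℝ → ℝ≥0∞}
    (hh : Measurable h) (lam : ℝ) :
    ∫⁻ t in Ioi 0, ENNReal.ofReal (Real.exp (-lam * t)) *
        ∫⁻ ω, (Ioi 0).indicator h (t - X ω) ∂P =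
      (∫⁻ ω, ENNReal.ofReal (Real.exp (-lam * X ω)) ∂P) *
        ∫⁻ t in Ioi 0, ENNReal.ofReal (Real.exp (-lam * t)) * h t := by
  have hi : Measurable ((Ioi (0 : ℝ)).indicator h) := hh.indicator measurableSet_Ioi
  simp_rw [← lintegral_const_mul' _ _ ENNReal.ofReal_ne_top]
  rw [lintegral_lintegral_swap, ← lintegral_mul_const _ (by fun_prop)]
  · exact lintegral_congr fun ω => lintegral_laplace_shift h lam (hX0 ω)
  · refine Measurable.aemeasurable ?_
    exact Measurable.mul (by fun_prop)
      (hi.comp (measurable_fst.sub (hX.comp measurable_snd)))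

theorem lintegral_exp_neg_mul_Ioi {c : ℝ} (hc : 0 < c) (q : ℝ) :
    ∫⁻ u in Ioi q, ENNReal.ofReal (Real.exp (-c * u)) =
      ENNReal.ofReal (Real.exp (-c * q) / c) := by
  rw [← ofReal_integral_eq_lintegral_ofReal (integrableOn_exp_mul_Ioi (by linarith) q)
    (.of_forall fun _ => (Real.exp_pos _).le), integral_exp_mul_Ioi (by linarith)]
  congr 1
  field_simp

/-- The density `u ↦ E[σ((t - S_u, ∞)); S_u < t]` of the inverse process at time `t`: the path
crosses the level `t` at the instant `u` by a jump from `S_u < t` to beyond `t`. Only `u > 0`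
matters; the value at `u < 0` is that at `0`. -/
noncomputable def crossingDensity {Ω : Type*} [MeasurableSpace Ω] (P : Measure Ω)
    (S : ℝ≥0 → Ω → ℝ) (σ : Measure ℝ) (t u : ℝ) : ℝ≥0∞ :=
  ∫⁻ ω, (Ioi 0).indicator (fun s => σ (Ioi s)) (t - S u.toNNReal ω) ∂P

section Crossing

variable {Ω : Type*} [MeasurableSpace Ω] {P : Measure Ω} [IsProbabilityMeasure P]
  {S : ℝ≥0 → Ω → ℝ} {σ : Measure ℝ}

theorem measurable_crossingDensity (hS : ∀ t, Measurable (S t))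
    (hpath : ∀ ω, IsSubordinatorPath fun t => S t ω) :
    Measurable (Function.uncurry (crossingDensity P S σ)) := by
  have hj := measurable_uncurry_of_rightContinuous hS fun ω => (hpath ω).rightContinuous
  have hi : Measurable ((Ioi (0 : ℝ)).indicator fun s => σ (Ioi s)) :=
    (measurable_measure_Ioi σ).indicator measurableSet_Ioi
  have h1 : Measurable fun q : (ℝ × ℝ) × Ω => q.1.1 - S q.1.2.toNNReal q.2 := by
    have h2 : Measurable fun q : (ℝ × ℝ) × Ω => (q.1.2.toNNReal, q.2) := by fun_prop
    exact (measurable_fst.comp measurable_fst).sub (hj.comp h2)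
  exact (hi.comp h1).lintegral_prod_right'

/-- The Laplace transform in time of `crossingDensity`. -/
theorem lintegral_laplace_crossingDensity (hS : ∀ t, Measurable (S t))
    (hpath : ∀ ω, IsSubordinatorPath fun t => S t ω)
    (hlap : ∀ lam : ℝ, 0 < lam → ∀ t : ℝ≥0, ∫⁻ ω, ENNReal.ofReal (Real.exp (-lam * S t ω)) ∂P =
      ENNReal.ofReal (Real.exp (-t * laplaceExponent σ lam)))
    {lam : ℝ} (hlam : 0 < lam) {u : ℝ} (hu : 0 ≤ u) :
    ∫⁻ t in Ioi 0, ENNReal.ofReal (Real.exp (-lam * t)) * crossingDensity P S σ t u =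
      ENNReal.ofReal (Real.exp (-laplaceExponent σ lam * u)) * kernelLaplace σ lam := by
  have := lintegral_laplace_shift_process (P := P) (hS u.toNNReal)
    (fun ω => (hpath ω).nonneg _) (measurable_measure_Ioi σ) lam
  simp only [crossingDensity]
  rw [this, hlap lam hlam, Real.coe_toNNReal u hu, kernelLaplace, neg_mul_comm, mul_comm u]

/-- Laplace transform in time of `t ↦ ∫ w(u) g_t(u) du`, with `g` the crossing density. -/
theorem lintegral_laplace_lintegral_crossingDensity (hS : ∀ t, Measurable (S t))
    (hpath : ∀ ω, IsSubordinatorPath fun t => S t ω)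
    (hlap : ∀ lam : ℝ, 0 < lam → ∀ t : ℝ≥0, ∫⁻ ω, ENNReal.ofReal (Real.exp (-lam * S t ω)) ∂P =
      ENNReal.ofReal (Real.exp (-t * laplaceExponent σ lam)))
    {w : ℝ → ℝ≥0∞} (hw : Measurable w) {lam : ℝ} (hlam : 0 < lam) {q : ℝ} (hq : 0 ≤ q) :
    ∫⁻ t in Ioi 0, ENNReal.ofReal (Real.exp (-lam * t)) *
        ∫⁻ u in Ioi q, w u * crossingDensity P S σ t u =
      (∫⁻ u in Ioi q, w u * ENNReal.ofReal (Real.exp (-laplaceExponent σ lam * u))) *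
        kernelLaplace σ lam := by
  have hg := measurable_crossingDensity (P := P) (σ := σ) hS hpath
  have hg' : ∀ u, Measurable fun t => crossingDensity P S σ t u := fun u =>
    hg.comp (measurable_id.prodMk measurable_const)
  simp_rw [← lintegral_const_mul' _ _ ENNReal.ofReal_ne_top]
  rw [lintegral_lintegral_swap, ← lintegral_mul_const _ (by fun_prop)]
  · refine setLIntegral_congr_fun measurableSet_Ioi fun u (hu : q < u) => ?_
    simp_rw [mul_left_comm _ (w u)]
    rw [lintegral_const_mul (f := fun t => ENNReal.ofReal (Real.exp (-lam * t)) *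
        crossingDensity P S σ t u) _ (Measurable.mul (by fun_prop) (hg' u)),
      lintegral_laplace_crossingDensity hS hpath hlap hlam (hq.trans hu.le), mul_assoc]
  · refine Measurable.aemeasurable ?_
    exact Measurable.mul (by fun_prop) ((hw.comp measurable_snd).mul hg)

/-- For almost every `t > 0` the law of the inverse process at time `t` has the crossing density:
the distribution functions agree because their Laplace transforms in `t` do. -/
theorem ae_map_inverseProcess_eq_withDensity (hS : ∀ t, Measurable (S t))
    (hpath : ∀ ω, IsSubordinatorPath fun t => S t ω)
    (hlap : ∀ lam : ℝ, 0 < lam → ∀ t : ℝ≥0, ∫⁻ ω, ENNReal.ofReal (Real.exp (-lam * S t ω)) ∂P =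
      ENNReal.ofReal (Real.exp (-t * laplaceExponent σ lam)))
    (hfin : ∀ lam, 0 < lam → kernelLaplace σ lam ≠ ∞)
    (hne : ∀ lam, 0 < lam → kernelLaplace σ lam ≠ 0) :
    ∀ᵐ t ∂volume.restrict (Ioi 0), P.map (inverseProcess S t) =
      (volume.restrict (Ioi 0)).withDensity (crossingDensity P S σ t) := by
  have hg := measurable_crossingDensity (P := P) (σ := σ) hS hpath
  have htail : ∀ q : ℝ≥0, ∀ᵐ t ∂volume.restrict (Ioi 0),
      P {ω | S q ω < t} = ∫⁻ u in Ioi (q : ℝ), crossingDensity P S σ t u := by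
    intro q
    have hcdf : ∀ t, P {ω | S q ω < t} = ∫⁻ ω, (Ioi 0).indicator 1 (t - S q ω) ∂P := by
      intro t
      rw [← lintegral_indicator_one (measurableSet_lt (hS q) measurable_const)]
      refine lintegral_congr fun ω => ?_
      simp [indicator]
    have hexp : ∀ lam, 0 < lam → ∫⁻ t in Ioi 0, ENNReal.ofReal (Real.exp (-lam * t)) *
        P {ω | S q ω < t} =
        ENNReal.ofReal (Real.exp (-q * laplaceExponent σ lam)) * ENNReal.ofReal lam⁻¹ := by
      intro lam hlam
      simp_rw [hcdf]
      rw [lintegral_laplace_shift_process (hS q) (fun ω => (hpath ω).nonneg q)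
        measurable_one, hlap lam hlam]
      simp only [Pi.one_apply, mul_one]
      rw [lintegral_exp_neg_mul_Ioi hlam]
      simp
    refine ae_eq_of_lintegral_laplace_eq
      (a := fun t => P {ω | S q ω < t})
      (b := fun t => ∫⁻ u in Ioi (q : ℝ), crossingDensity P S σ t u)
      (Monotone.measurable fun s t hst => measure_mono fun ω hω => lt_of_lt_of_le hω hst)
      hg.lintegral_prod_right' (fun lam hlam => ?_) ?_
    · have h1 := lintegral_laplace_lintegral_crossingDensity hS hpath hlap
        (w := fun _ => 1) measurable_const hlam q.coe_nonneg
      simp only [one_mul] at h1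
      have hK : 0 < (kernelLaplace σ lam).toReal := ENNReal.toReal_pos (hne lam hlam) (hfin lam hlam)
      have hΦ : laplaceExponent σ lam = lam * (kernelLaplace σ lam).toReal :=
        laplaceExponent_eq σ hlam
      have hΦ0 : 0 < laplaceExponent σ lam := hΦ ▸ mul_pos hlam hK
      rw [hexp lam hlam, h1, lintegral_exp_neg_mul_Ioi hΦ0,
        ← ENNReal.ofReal_toReal (hfin lam hlam), ← ENNReal.ofReal_mul (by positivity),
        ← ENNReal.ofReal_mul (by positivity), mul_comm (-(q : ℝ)), mul_neg, ← neg_mul]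
      congr 1
      generalize Real.exp _ = e
      rw [hΦ]
      field_simp
    · rw [hexp 1 one_pos]
      exact ENNReal.mul_ne_top ENNReal.ofReal_ne_top ENNReal.ofReal_ne_top
  have hall : ∀ᵐ t ∂volume.restrict (Ioi 0), ∀ q : ℚ≥0,
      P {ω | S (q : ℝ≥0) ω < t} = ∫⁻ u in Ioi ((q : ℝ≥0) : ℝ), crossingDensity P S σ t u :=
    ae_all_iff.2 fun q => htail q
  filter_upwards [hall, ae_restrict_mem measurableSet_Ioi] with t ht ht0
  have hE := measurable_inverseProcess hS hpath t
  have : IsProbabilityMeasure (P.map (inverseProcess S t)) :=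
    Measure.isProbabilityMeasure_map hE.aemeasurable
  have hmass : ∫⁻ u in Ioi (0 : ℝ), crossingDensity P S σ t u = 1 := by
    have h := ht 0
    have huniv : {ω | S 0 ω < t} = univ := by
      ext ω; simpa [(hpath ω).map_zero] using ht0
    simp only [NNRat.cast_zero, NNReal.coe_zero, huniv, measure_univ] at h
    exact h.symm
  refine ext_of_generate_finite _ ((BorelSpace.measurable_eq (α := ℝ)).trans
    Real.borel_eq_generateFrom_Ioi_rat) Real.isPiSystem_Ioi_rat ?_ ?_
  · intro s hs
    obtain ⟨q, rfl⟩ := mem_iUnion.1 hs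
    rw [Measure.map_apply hE measurableSet_Ioi, withDensity_apply _ measurableSet_Ioi,
      Measure.restrict_restrict measurableSet_Ioi, Ioi_inter_Ioi]
    rcases le_or_gt 0 q with hq | hq
    · lift q to ℚ≥0 using hq
      have hq' : (0 : ℝ) ≤ ((q : ℚ) : ℝ) := by positivity
      rw [max_eq_left hq']
      have hset : inverseProcess S t ⁻¹' Ioi (((q : ℚ) : ℝ)) = {ω | S (q : ℝ≥0) ω < t} := by
        ext ω
        exact lt_inverseProcess_iff (hpath ω) t q
      rw [hset]
      exact ht q
    · rw [max_eq_right (by exact_mod_cast hq.le), hmass]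
      have huniv : inverseProcess S t ⁻¹' Ioi (q : ℝ) = univ := by
        ext ω
        refine iff_of_true (lt_of_lt_of_le ?_ (NNReal.coe_nonneg _)) trivial
        exact_mod_cast hq
      rw [huniv, measure_univ]
  · rw [measure_univ, withDensity_apply _ MeasurableSet.univ, Measure.restrict_univ, hmass]

end Crossing

/-! ### Subordination and the Cesàro mean -/

/-- If the law of `E_t` has density `g` on `(0, ∞)`, then subordination integrates against `g`. -/
theorem subordination_inverseDensity_eq {Ω : Type*} [MeasurableSpace Ω] {P : Measure Ω}
    {S : ℝ≥0 → Ω → ℝ} {t : ℝ} {g : ℝ → ℝ≥0∞} (hg : Measurable g)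
    (hlaw : P.map (inverseProcess S t) = (volume.restrict (Ioi 0)).withDensity g)
    {f : ℝ → ℝ} {w : ℝ → ℝ≥0∞} (hw : Measurable w)
    (hfw : ∀ᵐ u ∂volume.restrict (Ioi 0), f u = (w u).toReal)
    (hgfin : ∫⁻ u in Ioi 0, w u * g u ≠ ∞) :
    subordination (inverseDensity P S) f t = (∫⁻ u in Ioi 0, w u * g u).toReal := by
  rw [← integral_toReal (f := fun u => w u * g u) (hw.mul hg).aemeasurable
    (ae_lt_top (hw.mul hg) hgfin), subordination]
  have hpdf : pdf (inverseProcess S t) P volume =ᵐ[volume] (Ioi 0).indicator g := by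
    rw [pdf, hlaw, ← withDensity_indicator measurableSet_Ioi]
    exact Measure.rnDeriv_withDensity _ (hg.indicator measurableSet_Ioi)
  refine integral_congr_ae ?_
  filter_upwards [ae_restrict_of_ae hpdf, hfw, ae_restrict_mem measurableSet_Ioi] with u h1 h2 h3
  rw [inverseDensity, h1, h2, indicator_of_mem h3, ENNReal.toReal_mul]

/-- A function `V ≥ 0` on `(0, ∞)` whose Laplace transform `ω` is finite and varies regularly
at `0` with index `-ρ` has primitive `∫₀ᵗ V ~ ω (1 / t) / Γ (ρ + 1)`. -/
theorem tendsto_lintegral_Ioc_div_laplace {V : ℝ → ℝ≥0∞} (hV : Measurable V) {ρ : ℝ} (hρ : 0 ≤ ρ)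
    {ω : ℝ → ℝ} (hpos : ∀ lam, 0 < lam → 0 < ω lam)
    (hω : ∀ lam, 0 < lam →
      ∫⁻ t in Ioi 0, ENNReal.ofReal (Real.exp (-lam * t)) * V t = ENNReal.ofReal (ω lam))
    (hreg : ∀ c : ℝ, 0 < c → Tendsto (fun lam => ω (c * lam) / ω lam) (𝓝[>] 0) (𝓝 (c ^ (-ρ)))) :
    Tendsto (fun T => (∫⁻ t in Ioc 0 T, V t).toReal / ω T⁻¹) atTop
      (𝓝 (1 / Real.Gamma (ρ + 1))) := by
  set U : Measure ℝ := (volume.restrict (Ioi 0)).withDensity V with hUdef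
  have hUpos : ∀ᵐ s ∂U, 0 ≤ s := (withDensity_absolutelyContinuous _ _).ae_le
    ((ae_restrict_mem measurableSet_Ioi).mono fun s hs => le_of_lt hs)
  have hlint : ∀ lam, 0 < lam → ∫⁻ s, ENNReal.ofReal (Real.exp (-lam * s)) ∂U =
      ENNReal.ofReal (ω lam) := by
    intro lam hlam
    rw [hUdef, lintegral_withDensity_eq_lintegral_mul _ hV
      (g := fun s => ENNReal.ofReal (Real.exp (-lam * s))) (by fun_prop), ← hω lam hlam]
    simp only [Pi.mul_apply, mul_comm]
  have h := tendsto_measureReal_Iic_div_laplace hUpos hρ (ω := ω) (fun lam hlam => ?_)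
    (fun lam hlam => ?_) hpos hreg
  · refine (h.comp tendsto_inv_atTop_nhdsGT_zero).congr' ?_
    filter_upwards with T
    simp only [Function.comp, inv_inv]
    rw [Measure.real, hUdef, withDensity_apply _ measurableSet_Iic,
      Measure.restrict_restrict measurableSet_Iic, Iic_inter_Ioi]
  · rw [integral_eq_lintegral_of_nonneg_ae (.of_forall fun _ => (Real.exp_pos _).le)
      (by fun_prop), hlint lam hlam, ENNReal.toReal_ofReal (hpos lam hlam).le]
  · refine ⟨by fun_prop, (hasFiniteIntegral_iff_ofReal
      (.of_forall fun _ => (Real.exp_pos _).le)).2 ?_⟩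
    rw [hlint lam hlam]
    exact ENNReal.ofReal_lt_top

/-- Slow variation of `y ^ (-ρ) * K (1 / y)` at infinity is regular variation of `K` at `0`. -/
theorem IsSlowlyVarying.tendsto_div {K : ℝ → ℝ} {ρ : ℝ}
    (hL : IsSlowlyVarying fun y => y ^ (-ρ) * K y⁻¹) {c : ℝ} (hc : 0 < c) :
    Tendsto (fun lam => K (c * lam) / K lam) (𝓝[>] 0) (𝓝 (c ^ (-ρ))) := by
  have h := ((hL c⁻¹ (inv_pos.2 hc)).comp tendsto_inv_nhdsGT_zero).const_mul (c ^ (-ρ))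
  rw [mul_one] at h
  refine h.congr' ?_
  filter_upwards [eventually_mem_nhdsWithin] with lam (hlam : 0 < lam)
  simp only [Function.comp, mul_inv, inv_inv]
  rw [Real.mul_rpow (by positivity) (by positivity), Real.inv_rpow hc.le]
  have h1 : c ^ (-ρ) ≠ 0 := (Real.rpow_pos_of_pos hc _).ne'
  have h2 : lam⁻¹ ^ (-ρ) ≠ 0 := (Real.rpow_pos_of_pos (inv_pos.2 hlam) _).ne'
  field_simp

theorem IsSlowlyVarying.exists_ne_zero {L : ℝ → ℝ} (hL : IsSlowlyVarying L) :
    ∃ y, L y ≠ 0 := by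
  have h := (hL 1 one_pos).eventually (lt_mem_nhds (zero_lt_one))
  obtain ⟨y, hy⟩ := h.exists
  exact ⟨y, fun h0 => by simp [h0] at hy⟩

/-- Dominated convergence: `∫ f(u) e^{-Φ u} du → ∫ f` as `Φ → 0⁺`. -/
theorem tendsto_integral_mul_exp_neg {f : ℝ → ℝ} (hf : IntegrableOn f (Ioi 0)) {ι : Type*}
    {l : Filter ι} [l.IsCountablyGenerated] {Φ : ι → ℝ} (hΦ : Tendsto Φ l (𝓝 0))
    (hΦ0 : ∀ᶠ i in l, 0 ≤ Φ i) :
    Tendsto (fun i => ∫ u in Ioi 0, f u * Real.exp (-Φ i * u)) l (𝓝 (∫ u in Ioi 0, f u)) := by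
  refine tendsto_integral_filter_of_dominated_convergence (fun u => ‖f u‖)
    (.of_forall fun i => hf.aestronglyMeasurable.mul (by fun_prop)) ?_ hf.norm
    (.of_forall fun u => ?_)
  · filter_upwards [hΦ0] with i hi
    filter_upwards [ae_restrict_mem measurableSet_Ioi] with u (hu : 0 < u)
    rw [norm_mul, Real.norm_of_nonneg (Real.exp_pos _).le]
    exact mul_le_of_le_one_right (norm_nonneg _) (Real.exp_le_one_iff.2 (by nlinarith))
  · have : Tendsto (fun i => f u * Real.exp (-Φ i * u)) l (𝓝 (f u * Real.exp (-0 * u))) :=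
      ((Real.continuous_exp.tendsto _).comp (hΦ.neg.mul_const u)).const_mul (f u)
    simpa using this

/-- The asymptotics of the Cesàro mean of the subordination of a nonnegative integrable function
with nonzero integral. -/
theorem tendsto_cesaroMean_subordination {Ω : Type*} [MeasurableSpace Ω] {P : Measure Ω}
    [IsProbabilityMeasure P] {S : ℝ≥0 → Ω → ℝ} {σ : Measure ℝ} (hS : IsSubordinator P S σ)
    {K : ℝ → ℝ} (hK : K = laplaceTransform (levyKernel σ))
    (hK_zero : Tendsto (fun lam => lam * K lam) (𝓝[>] 0) (𝓝 0))
    {ρ : ℝ} (hρ : 0 ≤ ρ) (hL : IsSlowlyVarying fun y => y ^ (-ρ) * K y⁻¹)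
    {f : ℝ → ℝ} (hf : IntegrableOn f (Ioi 0)) (hf0 : ∀ t, 0 < t → 0 ≤ f t)
    (hI : 0 < ∫ u in Ioi 0, f u) :
    Tendsto (fun t => cesaroMean (subordination (inverseDensity P S) f) t /
      ((∫ u in Ioi 0, f u) / Real.Gamma (ρ + 1) * (t⁻¹ * K t⁻¹))) atTop (𝓝 1) := by
  have hσ := hS.levyMeasure
  have hKeq : ∀ lam, K lam = (kernelLaplace σ lam).toReal := fun lam => by
    rw [hK, hσ.laplaceTransform_levyKernel]
  have hfin : ∀ lam, 0 < lam → kernelLaplace σ lam ≠ ∞ := fun lam => hσ.kernelLaplace_ne_top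
  -- A vanishing kernel is not slowly varying.
  have hne : ∀ lam, kernelLaplace σ lam ≠ 0 := by
    obtain ⟨y, hy⟩ := hL.exists_ne_zero
    refine kernelLaplace_ne_zero (lam₀ := y⁻¹) fun h0 => hy ?_
    simp [hKeq, h0]
  have hKpos : ∀ lam, 0 < lam → 0 < K lam := fun lam hlam => by
    rw [hKeq]; exact ENNReal.toReal_pos (hne lam) (hfin lam hlam)
  have hΦ : ∀ lam, 0 < lam → laplaceExponent σ lam = lam * K lam := fun lam hlam => by
    rw [hKeq, laplaceExponent_eq σ hlam]
  have hΦpos : ∀ lam, 0 < lam → 0 < laplaceExponent σ lam := fun lam hlam => by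
    rw [hΦ lam hlam]; exact mul_pos hlam (hKpos lam hlam)
  obtain ⟨S', hS'm, hpath, hSS'⟩ := hS.exists_version one_pos (hΦpos 1 one_pos)
  have hlap : ∀ lam : ℝ, 0 < lam → ∀ t : ℝ≥0,
      ∫⁻ ω, ENNReal.ofReal (Real.exp (-lam * S' t ω)) ∂P =
        ENNReal.ofReal (Real.exp (-t * laplaceExponent σ lam)) := by
    intro lam hlam t
    rw [← hS.lintegral_laplace hlam.le t]
    exact lintegral_congr_ae (hSS'.mono fun ω hω => by simp only [hω t])
  have hmap : ∀ t, P.map (inverseProcess S t) = P.map (inverseProcess S' t) := fun t =>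
    Measure.map_congr (hSS'.mono fun ω hω => by simp only [inverseProcess, hω])
  have hg := measurable_crossingDensity (P := P) (σ := σ) hS'm hpath
  -- A measurable representative of `f`, with values in `[0, ∞]`.
  obtain ⟨w, hw, hfw⟩ := hf.aemeasurable.ennreal_ofReal
  have hfw' : ∀ᵐ u ∂volume.restrict (Ioi 0), f u = (w u).toReal := by
    filter_upwards [hfw, ae_restrict_mem measurableSet_Ioi] with u hu hu0
    rw [← hu, ENNReal.toReal_ofReal (hf0 u hu0)]
  set V : ℝ → ℝ≥0∞ := fun t => ∫⁻ u in Ioi 0, w u * crossingDensity P S' σ t u with hV_def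
  have hV : Measurable V :=
    Measurable.lintegral_prod_right' (f := fun p : ℝ × ℝ => w p.2 * crossingDensity P S' σ p.1 p.2)
      ((hw.comp measurable_snd).mul hg)
  set J : ℝ → ℝ := fun lam => ∫ u in Ioi 0, f u * Real.exp (-laplaceExponent σ lam * u) with hJ_def
  have hJ_nonneg : ∀ᵐ u ∂volume.restrict (Ioi 0), ∀ c : ℝ, 0 ≤ f u * Real.exp (-c * u) := by
    filter_upwards [ae_restrict_mem measurableSet_Ioi] with u hu c
    exact mul_nonneg (hf0 u hu) (Real.exp_pos _).le
  have hJ_int : ∀ lam, 0 < lam →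
      IntegrableOn (fun u => f u * Real.exp (-laplaceExponent σ lam * u)) (Ioi 0) := by
    intro lam hlam
    refine Integrable.mono hf (hf.aestronglyMeasurable.mul (by fun_prop)) ?_
    filter_upwards [ae_restrict_mem measurableSet_Ioi] with u (hu : 0 < u)
    rw [norm_mul, Real.norm_of_nonneg (Real.exp_pos _).le]
    exact mul_le_of_le_one_right (norm_nonneg _)
      (Real.exp_le_one_iff.2 (by nlinarith [hΦpos lam hlam]))
  have hJpos : ∀ lam, 0 < lam → 0 < J lam := by
    intro lam hlam
    have hf0' : 0 ≤ᵐ[volume.restrict (Ioi 0)] f :=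
      (ae_restrict_mem measurableSet_Ioi).mono fun u hu => hf0 u hu
    rw [integral_pos_iff_support_of_nonneg_ae hf0' hf] at hI
    rw [hJ_def, integral_pos_iff_support_of_nonneg_ae
      (hJ_nonneg.mono fun u hu => hu _) (hJ_int lam hlam)]
    convert hI using 2
    ext u
    simp [Real.exp_ne_zero]
  have hω : ∀ lam, 0 < lam → ∫⁻ t in Ioi 0, ENNReal.ofReal (Real.exp (-lam * t)) * V t =
      ENNReal.ofReal (J lam * K lam) := by
    intro lam hlam
    rw [lintegral_laplace_lintegral_crossingDensity hS'm hpath hlap hw hlam le_rfl, hKeq,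
      ENNReal.ofReal_mul (hJpos lam hlam).le, ENNReal.ofReal_toReal (hfin lam hlam), hJ_def,
      ofReal_integral_eq_lintegral_ofReal (hJ_int lam hlam) (hJ_nonneg.mono fun u hu => hu _)]
    congr 1
    refine lintegral_congr_ae ?_
    filter_upwards [hfw, ae_restrict_mem measurableSet_Ioi] with u hu hu0
    rw [ENNReal.ofReal_mul (hf0 u hu0), hu]
  have hJ_lim : Tendsto J (𝓝[>] 0) (𝓝 (∫ u in Ioi 0, f u)) := by
    refine tendsto_integral_mul_exp_neg hf (hK_zero.congr' ?_) ?_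
    · filter_upwards [eventually_mem_nhdsWithin] with lam hlam using (hΦ lam hlam).symm
    · filter_upwards [eventually_mem_nhdsWithin] with lam hlam using (hΦpos lam hlam).le
  have hVfin : ∀ᵐ t ∂volume.restrict (Ioi 0), V t < ∞ := by
    have h1 : Measurable fun t => ENNReal.ofReal (Real.exp (-1 * t)) * V t :=
      Measurable.mul (by fun_prop) hV
    filter_upwards [ae_lt_top h1 ((hω 1 one_pos).trans_ne ENNReal.ofReal_ne_top)] with t ht
    exact ENNReal.lt_top_of_mul_ne_top_right ht.ne (by simp [Real.exp_pos])
  have hsub : ∀ᵐ t ∂volume.restrict (Ioi 0),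
      subordination (inverseDensity P S) f t = (V t).toReal := by
    filter_upwards [ae_map_inverseProcess_eq_withDensity hS'm hpath hlap hfin fun lam _ => hne lam,
      hVfin] with t ht hVt
    exact subordination_inverseDensity_eq (hg.comp (measurable_const.prodMk measurable_id))
      ((hmap t).trans ht) hw hfw' hVt.ne
  have hces : ∀ T, 0 < T → cesaroMean (subordination (inverseDensity P S) f) T =
      T⁻¹ * (∫⁻ t in Ioc 0 T, V t).toReal := by
    intro T hT
    have hsubset : Ioc (0 : ℝ) T ⊆ Ioi 0 := Ioc_subset_Ioi_self
    rw [cesaroMean, intervalIntegral.integral_of_le hT.le,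
      integral_congr_ae (ae_restrict_of_ae_restrict_of_subset hsubset hsub),
      integral_toReal hV.aemeasurable (ae_restrict_of_ae_restrict_of_subset hsubset hVfin)]
  have hreg : ∀ c : ℝ, 0 < c →
      Tendsto (fun lam => J (c * lam) * K (c * lam) / (J lam * K lam)) (𝓝[>] 0)
        (𝓝 (c ^ (-ρ))) := by
    intro c hc
    have hscale : Tendsto (fun lam : ℝ => c * lam) (𝓝[>] 0) (𝓝[>] 0) := by
      refine tendsto_nhdsWithin_iff.2 ⟨?_, ?_⟩
      · have : Tendsto (fun lam : ℝ => c * lam) (𝓝 0) (𝓝 (c * 0)) := tendsto_id.const_mul c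
        rw [mul_zero] at this
        exact this.mono_left nhdsWithin_le_nhds
      · filter_upwards [eventually_mem_nhdsWithin] with lam hlam using mul_pos hc hlam
    have h := ((hJ_lim.comp hscale).div hJ_lim hI.ne').mul (hL.tendsto_div hc)
    rw [div_self hI.ne', one_mul] at h
    refine h.congr fun lam => ?_
    simp only [Function.comp, Pi.div_apply]
    rw [div_mul_div_comm]
  have hmain := tendsto_lintegral_Ioc_div_laplace hV hρ
    (fun lam hlam => mul_pos (hJpos lam hlam) (hKpos lam hlam)) hω hreg
  have hΓ : 0 < Real.Gamma (ρ + 1) := Real.Gamma_pos_of_pos (by linarith)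
  have h := (hmain.mul (hJ_lim.comp tendsto_inv_atTop_nhdsGT_zero)).mul_const
    (Real.Gamma (ρ + 1) / ∫ u in Ioi 0, f u)
  have hone : 1 / Real.Gamma (ρ + 1) * (∫ u in Ioi 0, f u) *
      (Real.Gamma (ρ + 1) / ∫ u in Ioi 0, f u) = 1 := by
    have := hI.ne'
    field_simp
  rw [hone] at h
  refine h.congr' ?_
  filter_upwards [eventually_gt_atTop 0] with T hT
  have h1 := (hJpos T⁻¹ (inv_pos.2 hT)).ne'
  have h2 := (hKpos T⁻¹ (inv_pos.2 hT)).ne'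
  have h3 := hI.ne'
  rw [hces T hT]
  simp only [Function.comp]
  generalize J T⁻¹ = j at h1 ⊢
  generalize K T⁻¹ = k at h2 ⊢
  field_simp

theorem theorem1p2 {N : ℕ}
    (A : L1Space N →ₗ.[ℝ] L1Space N) (hA : IsMarkovGenerator A)
    (φ : EuclideanSpace ℝ (Fin N) → ℝ) (hφ : Integrable φ volume) (hφ_nonneg : ∀ y, 0 ≤ φ y)
    (v : EuclideanSpace ℝ (Fin N) → ℝ → ℝ) (hv : IsSolution A φ v)
    (x : EuclideanSpace ℝ (Fin N))
    (hv_nonneg : ∀ t, 0 < t → 0 ≤ v x t)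
    (hv_int : IntegrableOn (v x) (Ioi 0) volume)
    {Ω : Type*} [MeasurableSpace Ω] (P : Measure Ω) [IsProbabilityMeasure P]
    (S : ℝ≥0 → Ω → ℝ) (σ : Measure ℝ) (hS : IsSubordinator P S σ)
    (K : ℝ → ℝ) (hK : K = laplaceTransform (levyKernel σ))
    (hK_zero : Tendsto (fun lam => lam * K lam) (𝓝[>] 0) (𝓝 0))
    (ρ : ℝ) (hρ : 0 ≤ ρ)
    (hL : IsSlowlyVarying (fun y => y ^ (-ρ) * K y⁻¹)) :
    (fun t => cesaroMean (subordination (inverseDensity P S) (v x)) t) ~[atTop]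
      (fun t => (∫ τ in Ioi (0 : ℝ), |v x τ|) / Real.Gamma (ρ + 1) * (t⁻¹ * K t⁻¹)) := by
  have habs : ∫ τ in Ioi (0 : ℝ), |v x τ| = ∫ τ in Ioi (0 : ℝ), v x τ :=
    setIntegral_congr_fun measurableSet_Ioi fun τ hτ => abs_of_nonneg (hv_nonneg τ hτ)
  have h0 : 0 ≤ᵐ[volume.restrict (Ioi 0)] v x :=
    (ae_restrict_mem measurableSet_Ioi).mono fun τ hτ => hv_nonneg τ hτ
  rw [habs]
  rcases (integral_nonneg_of_ae h0).eq_or_lt with hI | hI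
  · -- If the integral vanishes then so does `v x` almost everywhere, and both sides are zero.
    have hvx := (integral_eq_zero_iff_of_nonneg_ae h0 hv_int).1 hI.symm
    have hsub : subordination (inverseDensity P S) (v x) = 0 := by
      ext t
      refine integral_eq_zero_of_ae (hvx.mono fun τ hτ => ?_)
      simp [hτ]
    rw [← hI, hsub]
    simp only [cesaroMean, Pi.zero_apply, intervalIntegral.integral_zero, mul_zero, zero_div,
      zero_mul]
    exact IsEquivalent.refl
  · exact isEquivalent_of_tendsto_one
      (tendsto_cesaroMean_subordination hS hK hK_zero hρ hL hv_int hv_nonneg hI)
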